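/- Let $n$ be an integer with $3\le n+1\le 7$, let $c>0$, and let $h\colon\mathbb{R}^{n+1}\to\mathbb{R}$ be a smooth function such that (H1) $h$ converges smoothly to $c$ at infinity, i.e. $h-c$ and all of its derivatives tend to $0$ as $\|x\|\to\infty$; (H2) there are numbers $\rho>0$ and $0<\sigma<1$ such that $|\nabla h(x)\cdot x|<\sigma h(x)$ whenever $\|x\|\ge\rho$. Let $\mathcal C(\mathbb{R}^{n+1})$ denote the set of Caccioppoli sets with compact support in $\mathbb{R}^{n+1}$ (sets differing by a null set being identified). For $\Omega\in\mathcal C(\mathbb{R}^{n+1})$ let $\operatorname{Area}(\partial\Omega)$ be the perimeter of $\Omega$, let $|\partial\Omega|$ be the varifold induced by its reduced boundary, and put $$A^h(\Omega)=\operatorname{Area}(\partial\Omega)-\int_\Omega h .$$ Equip $\mathcal C(\mathbb{R}^{n+1})$ with the metric $\mathbf F(\Omega_1,\Omega_2)=\operatorname{Vol}(\Omega_1\,\Delta\,\Omega_2)+\mathbf F(|\partial\Omega_1|,|\partial\Omega_2|)$, where for varifolds $V,W$ the number $\mathbf F(V,W)$ is the supremum of $V(f)-W(f)$ over all compactly supported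 functions $f$ on the Grassmann bundle of unoriented hyperplanes of $\mathbb{R}^{n+1}$ with $|f|\le 1$ and $\operatorname{Lip} f\le 1$. An $h$-mountain pass path is an $\mathbf F$-continuous family $\{\Omega_t\}_{t\in[0,1]}$ in $\mathcal C(\mathbb{R}^{n+1})$ with $\Omega_0=\emptyset$ and $A^h(\Omega_1)<0$. Let $\mathcal P$ be the set of all $h$-mountain pass paths and let $$\omega=\inf_{\{\Omega_t\}\in\mathcal P}\ \sup_{t\in[0,1]}A^h(\Omega_t)\in[-\infty,\infty]$$ be the one-parameter min-max width for $A^h$ (with $\inf\emptyset=+\infty$). Then $$0<\omega\le A^c(B_{n/c}),$$ where $B_{n/c}$ is the ball of radius $n/c$ centered at the origin and $A^c(\Omega)=\operatorname{Area}(\partial\Omega)-c\operatorname{Vol}(\Omega)$. -/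

import Mathlib

open MeasureTheory Filter Topology Set
open scoped ContDiff RealInnerProductSpace

noncomputable section

namespace PMC

/-- The Euclidean space `ℝ^{n+1}`. -/
abbrev E (n : ℕ) : Type := EuclideanSpace ℝ (Fin (n + 1))

instance factFinrank (n : ℕ) : Fact (Module.finrank ℝ (E n) = n + 1) := ⟨by simp⟩

/-! ### The Grassmannian of unoriented hyperplanes -/

/-- The Grassmannian `G(n+1, n)` of unoriented `n`-planes through the origin of `ℝ^{n+1}`. -/
def Gr (n : ℕ) : Type := {S : Submodule ℝ (E n) // Module.finrank ℝ S = n}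

/-- The orthogonal projection onto an `n`-plane. -/
def Gr.proj {n : ℕ} (S : Gr n) : E n →L[ℝ] E n := S.1.starProjection

theorem Gr.proj_injective (n : ℕ) : Function.Injective (Gr.proj (n := n)) := by
  intro S T h
  exact Subtype.ext (Submodule.starProjection_inj.mp h)

/-- The distance of two planes is the operator norm of the difference of the orthogonal
projections. -/
instance (n : ℕ) : MetricSpace (Gr n) :=
  MetricSpace.induced Gr.proj (Gr.proj_injective n) inferInstance

instance (n : ℕ) : MeasurableSpace (Gr n) := borel (Gr n)

instance (n : ℕ) : BorelSpace (Gr n) := ⟨rfl⟩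

/-- The hyperplane `v^⊥` orthogonal to a unit vector `v`. -/
def hyperplane {n : ℕ} (v : Metric.sphere (0 : E n) 1) : Gr n :=
  ⟨(Submodule.span ℝ {(v : E n)})ᗮ,
    Submodule.finrank_orthogonal_span_singleton (ne_zero_of_mem_unit_sphere v)⟩

theorem continuous_hyperplane (n : ℕ) : Continuous (hyperplane (n := n)) := by
  have hind : IsInducing (Gr.proj (n := n)) := ⟨rfl⟩
  rw [hind.continuous_iff]
  have h : Gr.proj ∘ hyperplane (n := n) = fun v : Metric.sphere (0 : E n) 1 =>
      ContinuousLinearMap.id ℝ (E n) - (innerSL ℝ (v : E n)).smulRight (v : E n) := by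
    funext v
    ext1 x
    have hv : ‖(v : E n)‖ = 1 := norm_eq_of_mem_sphere v
    simp [Gr.proj, hyperplane, Submodule.starProjection_orthogonal,
      Submodule.starProjection_unit_singleton ℝ hv]
  rw [h]
  have h2 : Continuous fun v : Metric.sphere (0 : E n) 1 =>
      ContinuousLinearMap.smulRightL ℝ (E n) (E n) (innerSL ℝ (v : E n)) (v : E n) := by
    fun_prop
  exact continuous_const.sub h2

/-! ### Caccioppoli sets -/

/-- The divergence of a vector field on `ℝ^{n+1}`. -/
def divergence {n : ℕ} (X : E n → E n) (x : E n) : ℝ :=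
  ∑ i, (fderiv ℝ X x (EuclideanSpace.single i 1)) i

/-- `μ` and the unit vector field `ν` form the polar decomposition of the Gauss–Green measure
of `Ω`: the distributional gradient of the indicator function of `Ω` is the finite vector-valued
measure `-ν μ` with `|ν| = 1`. So `μ` is the perimeter measure (the area measure of the reduced
boundary) and `ν` is the measure-theoretic outer unit normal. -/
structure IsGaussGreenPair {n : ℕ} (Ω : Set (E n)) (μ : Measure (E n))
    (ν : E n → Metric.sphere (0 : E n) 1) : Prop where
  finite : IsFiniteMeasure μ
  measurable : Measurable ν
  integral_divergence : ∀ X : E n → E n, ContDiff ℝ 1 X → HasCompactSupport X →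
    ∫ x in Ω, divergence X x = ∫ x, ⟪X x, (ν x : E n)⟫ ∂μ

/-- `Ω` has finite perimeter in `ℝ^{n+1}`. -/
def HasFinitePerimeter {n : ℕ} (Ω : Set (E n)) : Prop :=
  ∃ (μ : Measure (E n)) (ν : E n → Metric.sphere (0 : E n) 1), IsGaussGreenPair Ω μ ν

/-- `Ω` belongs to `𝒞(ℝ^{n+1})`: it is (a representative of) a Caccioppoli set with compact
support. -/
structure IsCaccioppoli {n : ℕ} (Ω : Set (E n)) : Prop where
  measurableSet : MeasurableSet Ω
  isBounded : Bornology.IsBounded Ω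
  hasFinitePerimeter : HasFinitePerimeter Ω

open Classical in
/-- The perimeter measure of a set of finite perimeter (see `IsGaussGreenPair.eq_perimeterMeasure`
for its uniqueness). -/
def perimeterMeasure {n : ℕ} (Ω : Set (E n)) : Measure (E n) :=
  if h : HasFinitePerimeter Ω then h.choose else 0

instance nonemptySphere (n : ℕ) : Nonempty (Metric.sphere (0 : E n) 1) :=
  ⟨⟨EuclideanSpace.single 0 1, by simp⟩⟩

open Classical in
/-- The measure-theoretic outer unit normal of a set of finite perimeter, unique almost everywhere
for the perimeter measure (see `IsGaussGreenPair.ae_eq_outerNormal`). -/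
def outerNormal {n : ℕ} (Ω : Set (E n)) : E n → Metric.sphere (0 : E n) 1 :=
  if h : HasFinitePerimeter Ω then h.choose_spec.choose else fun _ => Classical.arbitrary _

theorem HasFinitePerimeter.isGaussGreenPair {n : ℕ} {Ω : Set (E n)} (h : HasFinitePerimeter Ω) :
    IsGaussGreenPair Ω (perimeterMeasure Ω) (outerNormal Ω) := by
  simp only [perimeterMeasure, outerNormal, dif_pos h]
  exact h.choose_spec.choose_spec

/-- A finite measure is determined, and its unit vector field is determined almost everywhere, by
the vector-valued measure of which they are the polar decomposition. -/
theorem IsGaussGreenPair.unique {n : ℕ} {Ω : Set (E n)} {μ₁ μ₂ : Measure (E n)}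
    {ν₁ ν₂ : E n → Metric.sphere (0 : E n) 1} (h₁ : IsGaussGreenPair Ω μ₁ ν₁)
    (h₂ : IsGaussGreenPair Ω μ₂ ν₂) : μ₁ = μ₂ ∧ ν₁ =ᵐ[μ₁] ν₂ := by
  have f₁ := h₁.finite
  have f₂ := h₂.finite
  obtain ⟨m, hm⟩ : ∃ m, m = μ₁ + μ₂ := ⟨_, rfl⟩
  have fm : IsFiniteMeasure m := by rw [hm]; infer_instance
  have ac₁ : μ₁ ≪ m :=
    Measure.absolutelyContinuous_of_le (hm ▸ Measure.le_add_right le_rfl)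
  have ac₂ : μ₂ ≪ m :=
    Measure.absolutelyContinuous_of_le (hm ▸ Measure.le_add_left le_rfl)
  have hl : ∀ μ : Measure (E n), IsFiniteMeasure μ → μ.HaveLebesgueDecomposition m :=
    fun μ _ => Measure.haveLebesgueDecomposition_of_sigmaFinite μ m
  have hl₁ := hl μ₁ f₁
  have hl₂ := hl μ₂ f₂
  have key : ∀ {μ : Measure (E n)} {ν : E n → Metric.sphere (0 : E n) 1} (_ : IsFiniteMeasure μ),
      μ ≪ m → Measurable ν →
      Integrable (fun x => (μ.rnDeriv m x).toReal • (ν x : E n)) m ∧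
      ∀ X : E n → E n, ∫ x, ⟪X x, (ν x : E n)⟫ ∂μ
        = ∫ x, ⟪X x, (μ.rnDeriv m x).toReal • (ν x : E n)⟫ ∂m := by
    intro μ ν hμ hac hν
    have hlμ := hl μ hμ
    constructor
    · rw [integrable_rnDeriv_smul_iff hac]
      refine Integrable.of_bound (hν.subtype_val.aestronglyMeasurable) 1 ?_
      exact Eventually.of_forall fun x => (norm_eq_of_mem_sphere (ν x)).le
    · intro X
      rw [← integral_rnDeriv_smul hac]
      simp [inner_smul_right]
  obtain ⟨i₁, k₁⟩ := key h₁.finite ac₁ h₁.measurable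
  obtain ⟨i₂, k₂⟩ := key h₂.finite ac₂ h₂.measurable
  have hae : ∀ᵐ x ∂m, (μ₁.rnDeriv m x).toReal • (ν₁ x : E n)
      = (μ₂.rnDeriv m x).toReal • (ν₂ x : E n) := by
    have hcoord : ∀ i : Fin (n + 1), ∀ᵐ x ∂m,
        ((μ₁.rnDeriv m x).toReal • (ν₁ x : E n)) i
          = ((μ₂.rnDeriv m x).toReal • (ν₂ x : E n)) i := by
      intro i
      have j₁ := ((EuclideanSpace.proj i : E n →L[ℝ] ℝ).integrable_comp i₁).locallyIntegrable
      have j₂ := ((EuclideanSpace.proj i : E n →L[ℝ] ℝ).integrable_comp i₂).locallyIntegrable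
      refine ae_eq_of_integral_contDiff_smul_eq j₁ j₂ fun g hg hgc => ?_
      have hX : ContDiff ℝ 1 fun x => g x • (EuclideanSpace.single i 1 : E n) :=
        (hg.of_le (by norm_cast)).smul contDiff_const
      have hXc : HasCompactSupport fun x => g x • (EuclideanSpace.single i 1 : E n) :=
        hgc.smul_right
      have e := (h₁.integral_divergence _ hX hXc).symm.trans (h₂.integral_divergence _ hX hXc)
      rw [k₁, k₂] at e
      simpa [inner_smul_left, EuclideanSpace.inner_single_left] using e
    filter_upwards [ae_all_iff.mpr hcoord] with x hx
    ext i
    exact hx i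
  have hrn : μ₁.rnDeriv m =ᵐ[m] μ₂.rnDeriv m := by
    filter_upwards [hae, μ₁.rnDeriv_lt_top m, μ₂.rnDeriv_lt_top m] with x hx l₁ l₂
    have := congrArg norm hx
    rw [norm_smul, norm_smul, norm_eq_of_mem_sphere, norm_eq_of_mem_sphere] at this
    simp only [mul_one, Real.norm_eq_abs, ENNReal.abs_toReal] at this
    exact (ENNReal.toReal_eq_toReal_iff' l₁.ne l₂.ne).mp this
  refine ⟨?_, ?_⟩
  · rw [← Measure.withDensity_rnDeriv_eq μ₁ m ac₁, ← Measure.withDensity_rnDeriv_eq μ₂ m ac₂]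
    exact withDensity_congr_ae hrn
  · filter_upwards [ac₁ hae, ac₁ hrn, Measure.rnDeriv_pos ac₁, ac₁ (μ₁.rnDeriv_lt_top m)]
      with x hx hx2 hpos hlt
    rw [← hx2] at hx
    have hne : (μ₁.rnDeriv m x).toReal ≠ 0 := (ENNReal.toReal_pos hpos.ne' hlt.ne).ne'
    exact Subtype.ext (smul_right_injective (E n) hne hx)

theorem IsGaussGreenPair.eq_perimeterMeasure {n : ℕ} {Ω : Set (E n)} {μ : Measure (E n)}
    {ν : E n → Metric.sphere (0 : E n) 1} (h : IsGaussGreenPair Ω μ ν) :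
    perimeterMeasure Ω = μ :=
  ((HasFinitePerimeter.isGaussGreenPair ⟨μ, ν, h⟩).unique h).1

theorem IsGaussGreenPair.ae_eq_outerNormal {n : ℕ} {Ω : Set (E n)} {μ : Measure (E n)}
    {ν : E n → Metric.sphere (0 : E n) 1} (h : IsGaussGreenPair Ω μ ν) :
    outerNormal Ω =ᵐ[perimeterMeasure Ω] ν :=
  ((HasFinitePerimeter.isGaussGreenPair ⟨μ, ν, h⟩).unique h).2

/-- `Area(∂Ω)`: the total mass of the perimeter measure. -/
def area {n : ℕ} (Ω : Set (E n)) : ℝ := (perimeterMeasure Ω).real univ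

/-- The functional `A^h(Ω) = Area(∂Ω) - ∫_Ω h`. -/
def A {n : ℕ} (h : E n → ℝ) (Ω : Set (E n)) : ℝ := area Ω - ∫ x in Ω, h x

/-! ### The `F`-topology -/

/-- The varifold `|∂Ω|`, a measure on `ℝ^{n+1} × G(n+1, n)`: the perimeter measure of `Ω` pushed
forward by `x ↦ (x, ν(x)^⊥)`. -/
def boundaryVarifold {n : ℕ} (Ω : Set (E n)) : Measure (E n × Gr n) :=
  (perimeterMeasure Ω).map fun x => (x, hyperplane (outerNormal Ω x))

theorem HasFinitePerimeter.measurable_tangent {n : ℕ} {Ω : Set (E n)} (h : HasFinitePerimeter Ω) :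
    Measurable fun x => (x, hyperplane (outerNormal Ω x)) :=
  measurable_id.prodMk ((continuous_hyperplane n).measurable.comp h.isGaussGreenPair.measurable)

/-- The `F`-metric on (finite) varifolds: the supremum of `V(f) - W(f)` over all compactly
supported `f` on the Grassmann bundle with `|f| ≤ 1` and `Lip f ≤ 1`. -/
def varifoldDist {n : ℕ} (V W : Measure (E n × Gr n)) : ℝ :=
  sSup {r : ℝ | ∃ f : E n × Gr n → ℝ, HasCompactSupport f ∧ (∀ p, |f p| ≤ 1) ∧
    LipschitzWith 1 f ∧ r = ∫ p, f p ∂V - ∫ p, f p ∂W}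

/-- The flat metric `Vol(Ω₁ Δ Ω₂)`. -/
def flatDist {n : ℕ} (Ω₁ Ω₂ : Set (E n)) : ℝ := volume.real (symmDiff Ω₁ Ω₂)

/-- The `F`-metric on `𝒞(ℝ^{n+1})`. -/
def FDist {n : ℕ} (Ω₁ Ω₂ : Set (E n)) : ℝ :=
  flatDist Ω₁ Ω₂ + varifoldDist (boundaryVarifold Ω₁) (boundaryVarifold Ω₂)

/-! ### Mountain pass paths and the width -/

/-- An `h`-mountain pass path: a family `Ω_t`, `t ∈ [0,1]`, in `𝒞(ℝ^{n+1})`, continuous in the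
`F`-topology, with `Ω_0 = ∅` (up to a null set) and `A^h(Ω_1) < 0`. -/
structure IsMountainPassPath {n : ℕ} (h : E n → ℝ) (Ω : unitInterval → Set (E n)) : Prop where
  isCaccioppoli : ∀ t, IsCaccioppoli (Ω t)
  continuous : ∀ s, Tendsto (fun t => FDist (Ω t) (Ω s)) (𝓝 s) (𝓝 0)
  initial : Ω 0 =ᵐ[volume] (∅ : Set (E n))
  final : A h (Ω 1) < 0

/-- The one-parameter min-max width of `A^h`, as an extended real number. -/
def width {n : ℕ} (h : E n → ℝ) : EReal :=
  ⨅ (Ω : unitInterval → Set (E n)) (_ : IsMountainPassPath h Ω), ⨆ t, ((A h (Ω t) : ℝ) : EReal)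

/-! ### The hypotheses on `h` -/

/-- `h` converges smoothly to `c` at infinity: `h - c` tends to `0` at infinity together with all
its derivatives. -/
def ConvergesSmoothlyAtInfinity {n : ℕ} (h : E n → ℝ) (c : ℝ) : Prop :=
  ∀ k : ℕ, Tendsto (iteratedFDeriv ℝ k fun x => h x - c) (cocompact (E n)) (𝓝 0)

/-- The radial derivative condition: `|∇h(x) · x| < σ h(x)` for `‖x‖ ≥ ρ`, for some `ρ > 0` and
some `0 < σ < 1`. -/
def RadialDerivativeBound {n : ℕ} (h : E n → ℝ) : Prop :=
  ∃ ρ σ : ℝ, 0 < ρ ∧ 0 < σ ∧ σ < 1 ∧ ∀ x : E n, ρ ≤ ‖x‖ → |fderiv ℝ h x x| < σ * h x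

end PMC

end

/-!
Both inequalities come from explicit comparison; no existence theory for critical points enters.

*Lower bound* (`PMC.width_pos`). Let `M` bound `h` from above; it exists because `h` is continuous
and converges at infinity. By the isoperimetric inequality `PMC.IsGaussGreenPair.volume_le` the
ratio of area to volume tends to infinity as the volume tends to zero, so there is `v > 0` such that
`Area(∂Ω) ≥ 2 M Vol(Ω)`, hence `A^h(Ω) ≥ M Vol(Ω) ≥ 0`, whenever `Vol(Ω) ≤ v`. Along a mountain pass
path the volume is continuous and starts at `0`; since `A^h(Ω_1) < 0` it ends above `v`. Some `Ω_t`
has volume exactly `v`, and there `A^h ≥ M v > 0`. The isoperimetric inequality, with a constant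
that is not sharp, is the Gagliardo–Nirenberg–Sobolev inequality applied to mollified indicator
functions: by the Gauss–Green formula their gradients are mollifications of `-ν μ`, so that their
total variation is at most the perimeter.

*Upper bound* (`PMC.width_le`). Concentric balls `B_{tR}(p)`, `0 ≤ t ≤ 1`, form an `F`-continuous
family. When `R = (n + 2) / c` and `p` is far from the origin, `h` is nearly `c` on `B_R(p)`, so
`A^h` of these balls is uniformly close to `A^c(B_{tR}) = b ((n + 1) (tR)^n - c (tR)^{n+1})`, where
`b` is the volume of the unit ball. This is negative for `t = 1` and is largest at the radius
`n / c`. That balls are Caccioppoli sets with the area measure of the round sphere as perimeter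
measure is the divergence theorem `PMC.setIntegral_ball_divergence`, which is obtained from
integration by parts and polar coordinates.
-/

/-! ### The isoperimetric inequality -/

namespace PMC

open scoped Convolution

theorem clm_apply_eq_sum_single {n : ℕ} (L : E n →L[ℝ] ℝ) (v : E n) :
    L v = ∑ i, L (EuclideanSpace.single i 1) * v i := by
  have hv : v = ∑ i, v i • (EuclideanSpace.single i (1 : ℝ) : E n) := by
    ext j
    simp [Finset.sum_apply, Pi.single_apply]
  conv_lhs => rw [hv]
  simp [mul_comm]

theorem divergence_smul_const {n : ℕ} {g : E n → ℝ} {x : E n} (hg : DifferentiableAt ℝ g x)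
    (v : E n) : divergence (fun y => g y • v) x = fderiv ℝ g x v := by
  rw [clm_apply_eq_sum_single, divergence]
  refine Finset.sum_congr rfl fun i _ => ?_
  rw [fderiv_smul_const hg]
  simp

/-- The gradient of a mollified indicator function is the mollified Gauss–Green measure, up to
sign, so its norm is at most the mollified perimeter measure. -/
theorem IsGaussGreenPair.norm_fderiv_convolution_le {n : ℕ} {Ω : Set (E n)} {μ : Measure (E n)}
    {ν : E n → Metric.sphere (0 : E n) 1} (h : IsGaussGreenPair Ω μ ν) (hΩ : MeasurableSet Ω)
    {φ : E n → ℝ} (hφ : ContDiff ℝ 1 φ) (hφc : HasCompactSupport φ) (hφ0 : ∀ x, 0 ≤ φ x)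
    (x : E n) :
    ‖fderiv ℝ (φ ⋆[ContinuousLinearMap.lsmul ℝ ℝ, volume] Ω.indicator (fun _ => (1 : ℝ))) x‖
      ≤ ∫ y, φ (x - y) ∂μ := by
  have := h.finite
  have hloc : LocallyIntegrable (Ω.indicator fun _ => (1 : ℝ)) (volume : Measure (E n)) :=
    (locallyIntegrable_const (1 : ℝ)).indicator hΩ
  have hder := hφc.hasFDerivAt_convolution_left (ContinuousLinearMap.lsmul ℝ ℝ) hφ hloc x
  have hφ' : Continuous (fderiv ℝ φ) := hφ.continuous_fderiv one_ne_zero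
  have hψ : ContDiff ℝ 1 fun y => φ (x - y) := hφ.comp (contDiff_const.sub contDiff_id)
  have hψc : HasCompactSupport fun y => φ (x - y) :=
    hφc.comp_homeomorph (Homeomorph.subLeft x)
  have hint : Integrable (fun y => φ (x - y)) μ :=
    hψ.continuous.integrable_of_hasCompactSupport hψc
  rw [hder.fderiv]
  refine ContinuousLinearMap.opNorm_le_bound _ (integral_nonneg fun y => hφ0 _) fun v => ?_
  have hswap : ((fderiv ℝ φ ⋆[(ContinuousLinearMap.lsmul ℝ ℝ).precompL (E n), volume]
      Ω.indicator fun _ => (1 : ℝ)) x) v = ∫ y in Ω, fderiv ℝ φ (x - y) v := by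
    have hconv := (hφc.fderiv (𝕜 := ℝ)).convolutionExists_left
      ((ContinuousLinearMap.lsmul ℝ ℝ).precompL (E n)) hφ' hloc x
    rw [convolution_eq_swap, ← integral_indicator hΩ,
      ContinuousLinearMap.integral_apply hconv.integrable_swap]
    refine integral_congr_ae (Eventually.of_forall fun y => ?_)
    by_cases hy : y ∈ Ω <;> simp [hy, ContinuousLinearMap.precompL_apply]
  -- The Gauss–Green formula is applied to the field `y ↦ φ (x - y) v`.
  have hgg := h.integral_divergence (fun y => φ (x - y) • v) (hψ.smul contDiff_const)
    hψc.smul_right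
  have hdiv : ∀ y, divergence (fun y => φ (x - y) • v) y = - fderiv ℝ φ (x - y) v := by
    intro y
    rw [divergence_smul_const (hψ.differentiable one_ne_zero y)]
    have h1 : HasFDerivAt φ (fderiv ℝ φ (x - y)) (x - y) :=
      (hφ.differentiable one_ne_zero _).hasFDerivAt
    have h2 := h1.comp y ((hasFDerivAt_id y).const_sub x)
    have h3 := h2.fderiv
    simp only [Function.comp_def] at h3
    rw [h3]
    simp
  rw [hswap]
  simp only [hdiv, integral_neg] at hgg
  rw [neg_eq_iff_eq_neg.mp hgg, norm_neg, ← integral_mul_const]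
  refine norm_integral_le_of_norm_le (hint.mul_const _) (Eventually.of_forall fun y => ?_)
  rw [real_inner_smul_left, norm_mul, Real.norm_of_nonneg (hφ0 _)]
  refine mul_le_mul_of_nonneg_left ?_ (hφ0 _)
  simpa [norm_eq_of_mem_sphere] using norm_inner_le_norm (𝕜 := ℝ) v (ν y : E n)

/-- The total variation of a mollified indicator function is at most the perimeter. -/
theorem IsGaussGreenPair.lintegral_fderiv_convolution_le {n : ℕ} {Ω : Set (E n)}
    {μ : Measure (E n)} {ν : E n → Metric.sphere (0 : E n) 1} (h : IsGaussGreenPair Ω μ ν)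
    (hΩ : MeasurableSet Ω) (φ : ContDiffBump (0 : E n)) :
    ∫⁻ x, ‖fderiv ℝ (φ.normed volume ⋆[ContinuousLinearMap.lsmul ℝ ℝ, volume]
      Ω.indicator (fun _ => (1 : ℝ))) x‖ₑ ≤ μ univ := by
  have := h.finite
  have hc : Continuous (φ.normed volume) := φ.continuous_normed
  calc _ ≤ ∫⁻ x, ∫⁻ y, ENNReal.ofReal (φ.normed volume (x - y)) ∂μ := by
        refine lintegral_mono fun x => ?_
        have hi : Integrable (fun y => φ.normed volume (x - y)) μ :=
          (hc.comp (by fun_prop : Continuous fun y => x - y)).integrable_of_hasCompactSupport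
            (φ.hasCompactSupport_normed.comp_homeomorph (Homeomorph.subLeft x))
        rw [← ofReal_integral_eq_lintegral_ofReal hi
          (Eventually.of_forall fun y => φ.nonneg_normed _), ← ofReal_norm]
        exact ENNReal.ofReal_le_ofReal (h.norm_fderiv_convolution_le hΩ φ.contDiff_normed
          φ.hasCompactSupport_normed φ.nonneg_normed x)
    _ = ∫⁻ y, (∫⁻ x, ENNReal.ofReal (φ.normed volume (x - y))) ∂μ := by
        rw [lintegral_lintegral_swap]
        exact (ENNReal.continuous_ofReal.comp
          (hc.comp (continuous_fst.sub continuous_snd))).aemeasurable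
    _ = ∫⁻ y, 1 ∂μ := by
        refine lintegral_congr fun y => ?_
        rw [lintegral_sub_right_eq_self (fun x => ENNReal.ofReal (φ.normed volume x)) y,
          ← ofReal_integral_eq_lintegral_ofReal φ.integrable_normed
          (Eventually.of_forall fun y => φ.nonneg_normed _), φ.integral_normed,
          ENNReal.ofReal_one]
    _ = μ univ := by simp

/-- The bound on the ratio of the radii is what almost everywhere convergence of the mollifications
needs. -/
theorem exists_contDiffBump_seq (F : Type*) [NormedAddCommGroup F] :
    ∃ φ : ℕ → ContDiffBump (0 : F), Tendsto (fun k => (φ k).rOut) atTop (𝓝 0) ∧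
      ∀ k, (φ k).rOut ≤ 2 * (φ k).rIn := by
  refine ⟨fun k => ⟨1 / ((k : ℝ) + 1), 2 / ((k : ℝ) + 1), by positivity, by gcongr; norm_num⟩,
    ?_, fun k => ?_⟩
  · have := (tendsto_one_div_add_atTop_nhds_zero_nat (𝕜 := ℝ)).const_mul 2
    simpa [div_eq_mul_inv] using this
  · apply le_of_eq
    ring

/-- The isoperimetric inequality with a non-sharp constant: the Gagliardo–Nirenberg–Sobolev
inequality for mollified indicator functions, in the limit. -/
theorem IsGaussGreenPair.volume_le {n : ℕ} {p : ℝ}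
    (hp : Real.HolderConjugate (Module.finrank ℝ (E n)) p) {Ω : Set (E n)}
    {μ : Measure (E n)} {ν : E n → Metric.sphere (0 : E n) 1} (h : IsGaussGreenPair Ω μ ν)
    (hΩ : MeasurableSet Ω) (hb : Bornology.IsBounded Ω) :
    volume Ω ≤ lintegralPowLePowLIntegralFDerivConst (volume : Measure (E n)) p * μ univ ^ p := by
  have hp0 : 0 < p := hp.symm.pos
  have hloc : LocallyIntegrable (Ω.indicator fun _ => (1 : ℝ)) (volume : Measure (E n)) :=
    (locallyIntegrable_const (1 : ℝ)).indicator hΩ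
  have hcs : HasCompactSupport (Ω.indicator fun _ => (1 : ℝ)) :=
    HasCompactSupport.intro (Metric.isCompact_of_isClosed_isBounded isClosed_closure hb.closure)
      fun x hx => indicator_of_notMem (fun hx' => hx (subset_closure hx')) _
  obtain ⟨φ, hlim, hφ⟩ := exists_contDiffBump_seq (E n)
  obtain ⟨u, hu_def⟩ : ∃ u : ℕ → E n → ℝ, u = fun k => (φ k).normed volume
    ⋆[ContinuousLinearMap.lsmul ℝ ℝ, volume] Ω.indicator (fun _ => (1 : ℝ)) := ⟨_, rfl⟩
  have hu : ∀ k, ContDiff ℝ 1 (u k) := fun k => hu_def ▸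
    (φ k).hasCompactSupport_normed.contDiff_convolution_left _ (φ k).contDiff_normed hloc
  have huc : ∀ k, HasCompactSupport (u k) := fun k => hu_def ▸
    (φ k).hasCompactSupport_normed.convolution _ hcs
  have hu' : ∀ k, ∫⁻ x, ‖fderiv ℝ (u k) x‖ₑ ≤ μ univ := fun k => hu_def ▸
    h.lintegral_fderiv_convolution_le hΩ (φ k)
  have hae : ∀ᵐ x, Tendsto (fun k => u k x) atTop (𝓝 (Ω.indicator (fun _ => (1 : ℝ)) x)) :=
    hu_def ▸ ContDiffBump.ae_convolution_tendsto_right_of_locallyIntegrable (K := 2) hlim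
      (Eventually.of_forall hφ) hloc
  calc volume Ω = ∫⁻ x, ‖Ω.indicator (fun _ => (1 : ℝ)) x‖ₑ ^ p := by
        rw [← lintegral_indicator_one hΩ]
        refine lintegral_congr fun x => ?_
        by_cases hx : x ∈ Ω <;> simp [hx, hp0]
    _ = ∫⁻ x, liminf (fun k => ‖u k x‖ₑ ^ p) atTop := by
        refine lintegral_congr_ae ?_
        filter_upwards [hae] with x hx
        exact ((ENNReal.continuous_rpow_const.tendsto _).comp
          ((continuous_enorm.tendsto _).comp hx)).liminf_eq.symm
    _ ≤ liminf (fun k => ∫⁻ x, ‖u k x‖ₑ ^ p) atTop :=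
        lintegral_liminf_le fun k =>
          (ENNReal.continuous_rpow_const.comp (hu k).continuous.enorm).measurable
    _ ≤ liminf (fun _ : ℕ => (lintegralPowLePowLIntegralFDerivConst (volume : Measure (E n)) p *
          μ univ ^ p : ENNReal)) atTop := by
        refine liminf_le_liminf (Eventually.of_forall fun k => ?_)
        refine (lintegral_pow_le_pow_lintegral_fderiv volume (hu k) (huc k) hp).trans ?_
        gcongr
        exact hu' k
    _ = _ := by simp

end PMC

/-! ### The lower bound for the width -/

namespace PMC

theorem ConvergesSmoothlyAtInfinity.tendsto {n : ℕ} {h : E n → ℝ} {c : ℝ}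
    (H : ConvergesSmoothlyAtInfinity h c) : Tendsto h (cocompact (E n)) (𝓝 c) := by
  have h0 := tendsto_zero_iff_norm_tendsto_zero.mp (H 0)
  simp only [norm_iteratedFDeriv_zero] at h0
  exact tendsto_sub_nhds_zero_iff.mp (tendsto_zero_iff_norm_tendsto_zero.mpr h0)

theorem exists_forall_le_of_tendsto_cocompact {X : Type*} [TopologicalSpace X] {h : X → ℝ}
    {c : ℝ} (hc : Continuous h) (hl : Tendsto h (cocompact X) (𝓝 c)) :
    ∃ M, 0 < M ∧ ∀ x, h x ≤ M := by
  obtain ⟨K, hK, hKs⟩ := mem_cocompact.mp (hl.eventually (gt_mem_nhds (lt_add_one c)))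
  obtain ⟨B, hB⟩ := hK.bddAbove_image hc.continuousOn
  refine ⟨max 1 (max B (c + 1)), by positivity, fun x => ?_⟩
  by_cases hx : x ∈ K
  · exact (hB (mem_image_of_mem h hx)).trans ((le_max_left _ _).trans (le_max_right _ _))
  · exact (hKs hx).le.trans ((le_max_right _ _).trans (le_max_right _ _))

theorem IsCaccioppoli.volume_ne_top {n : ℕ} {Ω : Set (E n)} (h : IsCaccioppoli Ω) :
    volume Ω ≠ ⊤ := h.isBounded.measure_lt_top.ne

theorem IsCaccioppoli.integrableOn {n : ℕ} {Ω : Set (E n)} (hΩ : IsCaccioppoli Ω)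
    {h : E n → ℝ} (hc : Continuous h) : IntegrableOn h Ω :=
  (hc.continuousOn.integrableOn_compact (Metric.isCompact_of_isClosed_isBounded isClosed_closure
    hΩ.isBounded.closure)).mono_set subset_closure

theorem IsCaccioppoli.setIntegral_le {n : ℕ} {Ω : Set (E n)} (hΩ : IsCaccioppoli Ω)
    {h : E n → ℝ} (hc : Continuous h) {M : ℝ} (hM : ∀ x ∈ Ω, h x ≤ M) :
    ∫ x in Ω, h x ≤ M * volume.real Ω := by
  have := setIntegral_mono_on (hΩ.integrableOn hc) (hΩ.integrableOn continuous_const)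
    hΩ.measurableSet hM
  rwa [setIntegral_const, smul_eq_mul, mul_comm] at this

theorem IsCaccioppoli.volume_real_le {n : ℕ} (hn : 1 ≤ n) {Ω : Set (E n)} (h : IsCaccioppoli Ω) :
    volume.real Ω ≤ lintegralPowLePowLIntegralFDerivConst (volume : Measure (E n))
      (1 + (n : ℝ)⁻¹) * area Ω ^ (1 + (n : ℝ)⁻¹) := by
  have hn' : (0 : ℝ) < n := by exact_mod_cast hn
  have hp : Real.HolderConjugate (Module.finrank ℝ (E n)) (1 + (n : ℝ)⁻¹) := by
    rw [Real.holderConjugate_iff]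
    constructor
    · simp; omega
    · simp
      field_simp
      ring
  have hG := h.hasFinitePerimeter.isGaussGreenPair
  have := hG.finite
  have h1 := hG.volume_le hp h.measurableSet h.isBounded
  have hp0 : 0 ≤ 1 + (n : ℝ)⁻¹ := by positivity
  have h2 := ENNReal.toReal_mono (ENNReal.mul_ne_top ENNReal.coe_ne_top
    (ENNReal.rpow_ne_top_of_nonneg hp0 (measure_ne_top _ _))) h1
  simpa [measureReal_def, area, ENNReal.toReal_mul, ENNReal.toReal_rpow] using h2

/-- Sets of small volume have area at least any given multiple of their volume. -/
theorem exists_pos_forall_mul_volume_le_area {n : ℕ} (hn : 1 ≤ n) {M : ℝ} (hM : 0 < M) :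
    ∃ v, 0 < v ∧ ∀ Ω : Set (E n), IsCaccioppoli Ω → volume.real Ω ≤ v →
      M * volume.real Ω ≤ area Ω := by
  have hn' : (0 : ℝ) < n := by exact_mod_cast hn
  obtain ⟨C, hC⟩ : ∃ C : ℝ, C = lintegralPowLePowLIntegralFDerivConst (volume : Measure (E n))
      (1 + (n : ℝ)⁻¹) := ⟨_, rfl⟩
  have hC0 : 0 ≤ C := hC ▸ NNReal.coe_nonneg _
  -- `v` is so small that `C * M ^ (1 + 1 / n) * v ^ (1 / n) < 1`.
  have hlim : Tendsto (fun v : ℝ => C * M ^ (1 + (n : ℝ)⁻¹) * v ^ (n : ℝ)⁻¹) (𝓝[>] 0) (𝓝 0) := by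
    have : ContinuousAt (fun v : ℝ => C * M ^ (1 + (n : ℝ)⁻¹) * v ^ (n : ℝ)⁻¹) 0 :=
      continuousAt_const.mul (Real.continuousAt_rpow_const _ _ (Or.inr (by positivity)))
    have h := this.tendsto.mono_left (nhdsWithin_le_nhds (s := Ioi 0))
    simpa [Real.zero_rpow (inv_pos.mpr hn').ne'] using h
  obtain ⟨v, hv1, hv0⟩ := ((hlim.eventually (gt_mem_nhds one_pos)).and
    self_mem_nhdsWithin).exists
  refine ⟨v, hv0, fun Ω hΩ hle => ?_⟩
  by_contra! hlt
  have ha : 0 ≤ area Ω := measureReal_nonneg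
  have hpos : 0 < volume.real Ω := pos_of_mul_pos_right (ha.trans_lt hlt) hM.le
  have h1 := hΩ.volume_real_le hn
  rw [← hC] at h1
  have h2 : volume.real Ω ≤ C * M ^ (1 + (n : ℝ)⁻¹) * v ^ (n : ℝ)⁻¹ * volume.real Ω :=
    calc volume.real Ω ≤ C * area Ω ^ (1 + (n : ℝ)⁻¹) := h1
      _ ≤ C * (M * volume.real Ω) ^ (1 + (n : ℝ)⁻¹) := by gcongr
      _ = C * M ^ (1 + (n : ℝ)⁻¹) * volume.real Ω ^ (n : ℝ)⁻¹ * volume.real Ω := by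
          rw [Real.mul_rpow hM.le hpos.le, Real.rpow_add hpos, Real.rpow_one]
          ring
      _ ≤ _ := by gcongr
  nlinarith

theorem varifoldDist_nonneg {n : ℕ} (V W : Measure (E n × Gr n)) : 0 ≤ varifoldDist V W :=
  Real.sSup_nonneg' ⟨0, ⟨fun _ => 0, HasCompactSupport.zero, by simp,
    LipschitzWith.const' 0, by simp⟩, le_rfl⟩

theorem IsMountainPassPath.continuous_volume {n : ℕ} {h : E n → ℝ}
    {Ω : unitInterval → Set (E n)} (hΩ : IsMountainPassPath h Ω) :
    Continuous fun t => volume.real (Ω t) := by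
  refine continuous_iff_continuousAt.mpr fun s => ?_
  refine tendsto_iff_dist_tendsto_zero.mpr (squeeze_zero (fun _ => dist_nonneg) (fun t => ?_)
    (hΩ.continuous s))
  calc dist (volume.real (Ω t)) (volume.real (Ω s)) ≤ flatDist (Ω t) (Ω s) :=
        abs_measureReal_sub_le_measureReal_symmDiff'
          (hΩ.isCaccioppoli t).measurableSet.nullMeasurableSet
          (hΩ.isCaccioppoli s).measurableSet.nullMeasurableSet
          (hΩ.isCaccioppoli t).volume_ne_top (hΩ.isCaccioppoli s).volume_ne_top
    _ ≤ FDist (Ω t) (Ω s) := le_add_of_nonneg_right (varifoldDist_nonneg _ _)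

/-- Every mountain pass path contains a set of some fixed small volume, and such a set has `A^h`
bounded below by the isoperimetric inequality. -/
theorem width_pos {n : ℕ} (hn : 1 ≤ n) {h : E n → ℝ} (hc : Continuous h) {M : ℝ} (hM0 : 0 < M)
    (hM : ∀ x, h x ≤ M) : 0 < width h := by
  obtain ⟨v, hv0, hv⟩ := exists_pos_forall_mul_volume_le_area hn (mul_pos two_pos hM0)
  have key : ∀ Ω : Set (E n), IsCaccioppoli Ω → volume.real Ω ≤ v →
      M * volume.real Ω ≤ A h Ω := by
    intro Ω hΩ hle
    have h1 := hv Ω hΩ hle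
    have h2 := hΩ.setIntegral_le hc fun x _ => hM x
    unfold A
    linarith
  refine lt_of_lt_of_le (EReal.coe_pos.mpr (mul_pos hM0 hv0)) (le_iInf₂ fun Ω hΩ => ?_)
  have h0 : volume.real (Ω 0) = 0 := by
    rw [measureReal_congr hΩ.initial, measureReal_empty]
  have h1 : v ≤ volume.real (Ω 1) := by
    by_contra! hlt
    have := key _ (hΩ.isCaccioppoli 1) hlt.le
    have h2 : 0 ≤ M * volume.real (Ω 1) := by positivity
    linarith [hΩ.final]
  obtain ⟨t, ht⟩ := mem_range_of_exists_le_of_exists_ge hΩ.continuous_volume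
    ⟨0, h0.le.trans hv0.le⟩ ⟨1, h1⟩
  refine le_iSup_of_le t (EReal.coe_le_coe_iff.mpr ?_)
  have := key _ (hΩ.isCaccioppoli t) ht.le
  simp only at ht
  rwa [ht] at this

end PMC

/-! ### Polar coordinates and integration by parts -/

/-- Integration in polar coordinates. -/
theorem integral_eq_integral_Ioi_toSphere {V : Type*} [NormedAddCommGroup V] [NormedSpace ℝ V]
    [Nontrivial V] [FiniteDimensional ℝ V] [MeasurableSpace V] [BorelSpace V] (μ : Measure V)
    [μ.IsAddHaarMeasure] {f : V → ℝ} (hf : Integrable f μ) :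
    ∫ x, f x ∂μ = ∫ s in Ioi (0 : ℝ), s ^ (Module.finrank ℝ V - 1) *
      ∫ θ : Metric.sphere (0 : V) 1, f (s • (θ : V)) ∂μ.toSphere := by
  have hmp := μ.measurePreserving_homeomorphUnitSphereProd
  have hemb := (homeomorphUnitSphereProd V).measurableEmbedding
  let g : Metric.sphere (0 : V) 1 × Ioi (0 : ℝ) → ℝ := fun z => f (z.2.1 • (z.1 : V))
  have hg : ∀ x : ({0}ᶜ : Set V), g (homeomorphUnitSphereProd V x) = f x := by
    intro x
    have hx : ‖(x : V)‖ ≠ 0 := norm_ne_zero_iff.mpr x.2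
    simp [g, smul_smul, hx]
  have hgi : Integrable g (μ.toSphere.prod (.volumeIoiPow (Module.finrank ℝ V - 1))) := by
    rw [← hmp.integrable_comp_emb hemb]
    refine Integrable.congr (f := fun x : ({0}ᶜ : Set V) => f x) ?_
      (Eventually.of_forall fun x => (hg x).symm)
    exact (integrableOn_iff_comap_subtypeVal (measurableSet_singleton _).compl).mp hf.integrableOn
  calc ∫ x, f x ∂μ = ∫ x : ({(0)}ᶜ : Set V), f x ∂(μ.comap (↑)) := by
        rw [integral_subtype_comap (measurableSet_singleton _).compl fun x => f x,
          restrict_compl_singleton]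
    _ = ∫ z, g z ∂(μ.toSphere.prod (.volumeIoiPow (Module.finrank ℝ V - 1))) := by
        rw [← hmp.integral_comp hemb]
        exact integral_congr_ae (Eventually.of_forall fun x => (hg x).symm)
    _ = ∫ s : Ioi (0 : ℝ), (∫ θ : Metric.sphere (0 : V) 1, f (s.1 • (θ : V)) ∂μ.toSphere)
          ∂(.volumeIoiPow (Module.finrank ℝ V - 1)) := integral_prod_symm _ hgi
    _ = _ := by
        simp only [Measure.volumeIoiPow, ENNReal.ofReal]
        rw [integral_withDensity_eq_integral_smul,
          integral_subtype_comap measurableSet_Ioi fun a =>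
            Real.toNNReal (a ^ (Module.finrank ℝ V - 1)) •
              ∫ θ : Metric.sphere (0 : V) 1, f (a • (θ : V)) ∂μ.toSphere]
        · refine setIntegral_congr_fun measurableSet_Ioi fun x hx => ?_
          simp only [NNReal.smul_def, smul_eq_mul]
          rw [Real.coe_toNNReal _ (pow_nonneg (le_of_lt hx) _)]
        · exact (measurable_subtype_coe.pow_const _).real_toNNReal

namespace PMC

theorem continuous_divergence {n : ℕ} {X : E n → E n} (hX : ContDiff ℝ 1 X) :
    Continuous (divergence X) := by
  have h := hX.continuous_fderiv one_ne_zero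
  unfold divergence
  fun_prop

theorem hasCompactSupport_divergence {n : ℕ} {X : E n → E n} (hX : HasCompactSupport X) :
    HasCompactSupport (divergence X) := by
  refine (hX.fderiv (𝕜 := ℝ)).mono fun x hx hx' => hx ?_
  simp [divergence, hx']

/-- Only the vector field needs compact support. -/
theorem integral_mul_divergence {n : ℕ} {ζ : E n → ℝ} {X : E n → E n} (hζ : ContDiff ℝ 1 ζ)
    (hX : ContDiff ℝ 1 X) (hXc : HasCompactSupport X) :
    ∫ x, ζ x * divergence X x = -∫ x, fderiv ℝ ζ x (X x) := by
  have hX' := hX.continuous_fderiv one_ne_zero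
  have hζ' := hζ.continuous_fderiv one_ne_zero
  have hi : ∀ i, ContDiff ℝ 1 fun x => X x i := fun i =>
    (EuclideanSpace.proj i : E n →L[ℝ] ℝ).contDiff.comp hX
  have hic : ∀ i, HasCompactSupport fun x => X x i := fun i =>
    hXc.comp_left (g := fun v : E n => v i) rfl
  have hdi : ∀ i x, fderiv ℝ X x (EuclideanSpace.single i 1) i
      = fderiv ℝ (fun y => X y i) x (EuclideanSpace.single i 1) := by
    intro i x
    have h1 := (EuclideanSpace.proj i : E n →L[ℝ] ℝ).hasFDerivAt.comp x
      (hX.differentiable one_ne_zero x).hasFDerivAt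
    have h2 : fderiv ℝ (fun y => X y i) x = _ := h1.fderiv
    rw [h2]
    simp
  have hdec : ∀ x, fderiv ℝ ζ x (X x)
      = ∑ i, fderiv ℝ ζ x (EuclideanSpace.single i 1) * X x i := fun x =>
    clm_apply_eq_sum_single _ _
  have hdc : ∀ i, Continuous fun x => fderiv ℝ (fun y => X y i) x (EuclideanSpace.single i 1) :=
    fun i => ((hi i).continuous_fderiv one_ne_zero).clm_apply continuous_const
  have hdcs : ∀ i, HasCompactSupport
      fun x => fderiv ℝ (fun y => X y i) x (EuclideanSpace.single i 1) :=
    fun i => ((hic i).fderiv (𝕜 := ℝ)).comp_left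
      (g := fun L : E n →L[ℝ] ℝ => L (EuclideanSpace.single i 1)) rfl
  have I1 : ∀ i, Integrable fun x =>
      ζ x * fderiv ℝ (fun y => X y i) x (EuclideanSpace.single i 1) := fun i =>
    (hζ.continuous.mul (hdc i)).integrable_of_hasCompactSupport (hdcs i).mul_left
  have I2 : ∀ i, Integrable fun x => fderiv ℝ ζ x (EuclideanSpace.single i 1) * X x i :=
    fun i => ((hζ'.clm_apply continuous_const).mul
      (hi i).continuous).integrable_of_hasCompactSupport (hic i).mul_left
  have I3 : ∀ i, Integrable fun x => ζ x * X x i := fun i =>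
    (hζ.continuous.mul (hi i).continuous).integrable_of_hasCompactSupport (hic i).mul_left
  simp only [divergence, Finset.mul_sum, hdi, hdec]
  rw [integral_finsetSum _ fun i _ => I1 i, integral_finsetSum _ fun i _ => I2 i,
    ← Finset.sum_neg_distrib]
  refine Finset.sum_congr rfl fun i _ => ?_
  exact integral_mul_fderiv_eq_neg_fderiv_mul_of_integrable (I2 i) (I1 i) (I3 i)
    (fun x _ => hζ.differentiable one_ne_zero x) (fun x _ => (hi i).differentiable one_ne_zero x)

end PMC

/-! ### The divergence theorem on balls -/

theorem hasFDerivAt_norm_of_ne_zero {V : Type*} [NormedAddCommGroup V] [InnerProductSpace ℝ V]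
    {x : V} (hx : x ≠ 0) : HasFDerivAt (fun y : V => ‖y‖) (‖x‖⁻¹ • innerSL ℝ x) x := by
  have h := (hasStrictFDerivAt_norm_sq x).hasFDerivAt.sqrt (pow_ne_zero 2 (norm_ne_zero_iff.mpr hx))
  simp only [Real.sqrt_sq (norm_nonneg _)] at h
  convert h using 1
  ext v
  have := norm_ne_zero_iff.mpr hx
  simp
  field_simp

theorem hasDerivAt_integral_Ioi {ψ : ℝ → ℝ} (hψ : Continuous ψ) (hi : Integrable ψ) (s : ℝ) :
    HasDerivAt (fun s => ∫ t in Ioi s, ψ t) (-ψ s) s := by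
  have h : (fun s => ∫ t in Ioi s, ψ t)
      = fun s => (∫ t in Ioi (0 : ℝ), ψ t) - ∫ t in (0 : ℝ)..s, ψ t := by
    funext s
    rw [← intervalIntegral.integral_Ioi_sub_Ioi' hi.integrableOn hi.integrableOn]
    ring
  rw [h]
  exact (intervalIntegral.integral_hasDerivAt_right hi.intervalIntegrable
    (hψ.stronglyMeasurableAtFilter _ _) hψ.continuousAt).const_sub _

/-- If `ψ` is supported in `(0, ∞)`, then the radial function `x ↦ ∫_{|x|}^∞ ψ` is `C¹`, also at
the origin, near which it is constant. -/
theorem contDiff_integral_Ioi_norm {V : Type*} [NormedAddCommGroup V] [InnerProductSpace ℝ V]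
    {ψ : ℝ → ℝ} (hψ : Continuous ψ) (hc : HasCompactSupport ψ) (hs : tsupport ψ ⊆ Ioi 0) :
    ContDiff ℝ 1 fun x : V => ∫ t in Ioi ‖x‖, ψ t := by
  have hi : Integrable ψ := hψ.integrable_of_hasCompactSupport hc
  have hη : ContDiff ℝ 1 fun s => ∫ t in Ioi s, ψ t := by
    rw [contDiff_one_iff_deriv]
    refine ⟨fun s => (hasDerivAt_integral_Ioi hψ hi s).differentiableAt, ?_⟩
    rw [funext fun s => (hasDerivAt_integral_Ioi hψ hi s).deriv]
    exact hψ.neg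
  refine contDiff_iff_contDiffAt.mpr fun x => ?_
  by_cases hx : x = 0
  · subst hx
    have h0 : ∀ᶠ s in 𝓝 (0 : ℝ), ψ =ᶠ[𝓝 s] 0 :=
      (notMem_tsupport_iff_eventuallyEq.mp fun h => lt_irrefl (0 : ℝ) (hs h)).eventually_nhds
    obtain ⟨δ, hδ, hball⟩ := Metric.eventually_nhds_iff.mp h0
    refine (contDiffAt_const (c := ∫ t in Ioi (0 : ℝ), ψ t)).congr_of_eventuallyEq ?_
    filter_upwards [Metric.ball_mem_nhds (0 : V) hδ] with x hx
    rw [← intervalIntegral.integral_interval_add_Ioi (a := 0) (b := ‖x‖) hi.integrableOn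
      hi.integrableOn]
    have : ∫ t in (0 : ℝ)..‖x‖, ψ t = ∫ t in (0 : ℝ)..‖x‖, (0 : ℝ) := by
      refine intervalIntegral.integral_congr fun t ht => ?_
      rw [uIcc_of_le (norm_nonneg x)] at ht
      refine (hball ?_).self_of_nhds
      rw [Real.dist_eq, sub_zero, abs_of_nonneg ht.1]
      exact ht.2.trans_lt (by simpa using hx)
    rw [this]
    simp
  · exact hη.contDiffAt.comp x (contDiffAt_norm ℝ hx)

theorem fderiv_integral_Ioi_norm {V : Type*} [NormedAddCommGroup V] [InnerProductSpace ℝ V]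
    {ψ : ℝ → ℝ} (hψ : Continuous ψ) (hi : Integrable ψ) {x : V} (hx : x ≠ 0) (v : V) :
    fderiv ℝ (fun x : V => ∫ t in Ioi ‖x‖, ψ t) x v = -(ψ ‖x‖ * ⟪v, ‖x‖⁻¹ • x⟫) := by
  have h := (hasDerivAt_integral_Ioi hψ hi ‖x‖).comp_hasFDerivAt x (hasFDerivAt_norm_of_ne_zero hx)
  have h2 : fderiv ℝ (fun x : V => ∫ t in Ioi ‖x‖, ψ t) x = _ := h.fderiv
  rw [h2]
  simp [real_inner_smul_right, real_inner_comm]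

/-- Layer cake for a radial weight. -/
theorem integral_integral_Ioi_norm_mul {V : Type*} [NormedAddCommGroup V] [MeasurableSpace V]
    [BorelSpace V] [SecondCountableTopology V] {μ : Measure V} [SFinite μ] {ψ : ℝ → ℝ} {f : V → ℝ}
    (hψ : Integrable ψ) (hf : Integrable f μ) :
    ∫ x, (∫ t in Ioi ‖x‖, ψ t) * f x ∂μ = ∫ t, ψ t * ∫ x in Metric.ball 0 t, f x ∂μ := by
  have hS : MeasurableSet {z : V × ℝ | ‖z.1‖ < z.2} :=
    (isOpen_lt (by fun_prop) (by fun_prop)).measurableSet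
  have hint : Integrable (Function.uncurry fun (x : V) (t : ℝ) =>
      {z : V × ℝ | ‖z.1‖ < z.2}.indicator (fun z => f z.1 * ψ z.2) (x, t)) (μ.prod volume) :=
    (hf.mul_prod hψ).indicator hS
  calc _ = ∫ x, (∫ t, {z : V × ℝ | ‖z.1‖ < z.2}.indicator (fun z => f z.1 * ψ z.2) (x, t)) ∂μ := by
        refine integral_congr_ae (Eventually.of_forall fun x => ?_)
        simp only
        rw [← integral_mul_const, ← integral_indicator measurableSet_Ioi]
        refine integral_congr_ae (Eventually.of_forall fun t => ?_)
        by_cases h : ‖x‖ < t <;> simp [h, mul_comm]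
    _ = ∫ t, ∫ x, {z : V × ℝ | ‖z.1‖ < z.2}.indicator (fun z => f z.1 * ψ z.2) (x, t) ∂μ :=
        integral_integral_swap hint
    _ = _ := by
        refine integral_congr_ae (Eventually.of_forall fun t => ?_)
        simp only
        rw [← integral_const_mul, ← integral_indicator Metric.isOpen_ball.measurableSet]
        refine integral_congr_ae (Eventually.of_forall fun x => ?_)
        by_cases h : ‖x‖ < t <;> simp [h, mul_comm]

theorem continuous_setIntegral_ball {V : Type*} [NormedAddCommGroup V] [NormedSpace ℝ V]
    [Nontrivial V] [FiniteDimensional ℝ V] [MeasurableSpace V] [BorelSpace V] (μ : Measure V)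
    [μ.IsAddHaarMeasure] {f : V → ℝ} (hf : Integrable f μ) :
    Continuous fun t => ∫ x in Metric.ball 0 t, f x ∂μ := by
  refine continuous_iff_continuousAt.mpr fun t => ?_
  simp only [← integral_indicator Metric.isOpen_ball.measurableSet]
  refine continuousAt_of_dominated (bound := fun x => ‖f x‖)
    (Eventually.of_forall fun s => hf.aestronglyMeasurable.indicator
      Metric.isOpen_ball.measurableSet)
    (Eventually.of_forall fun s => Eventually.of_forall fun x => norm_indicator_le_norm_self _ _)
    hf.norm ?_
  have hnull : ∀ᵐ x ∂μ, x ∉ Metric.sphere (0 : V) t :=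
    measure_eq_zero_iff_ae_notMem.mp (Measure.addHaar_sphere μ 0 t)
  filter_upwards [hnull] with x hx
  rcases lt_or_gt_of_ne (fun h => hx (by simpa using h) : ‖x‖ ≠ t) with h | h
  · refine (continuousAt_const (y := f x)).congr ?_
    filter_upwards [lt_mem_nhds h] with s hs
    rw [indicator_of_mem (by simpa using hs)]
  · refine (continuousAt_const (y := (0 : ℝ))).congr ?_
    filter_upwards [gt_mem_nhds h] with s hs
    rw [indicator_of_notMem (by simpa using hs.le)]

namespace PMC

theorem continuous_sphere_flux {n : ℕ} {X : E n → E n} (hX : Continuous X)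
    (hXc : HasCompactSupport X) :
    Continuous fun t : ℝ => ∫ θ : Metric.sphere (0 : E n) 1, ⟪X (t • (θ : E n)), (θ : E n)⟫
      ∂(volume : Measure (E n)).toSphere := by
  obtain ⟨C, hC⟩ := hX.bounded_above_of_compact_support hXc
  refine continuous_of_dominated (bound := fun _ => C) (fun t => ?_) (fun t => ?_)
    (integrable_const _) (Eventually.of_forall fun θ => by fun_prop)
  · exact (by fun_prop : Continuous fun θ : Metric.sphere (0 : E n) 1 =>
      ⟪X (t • (θ : E n)), (θ : E n)⟫).aestronglyMeasurable
  · refine Eventually.of_forall fun θ => (norm_inner_le_norm _ _).trans ?_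
    rw [norm_eq_of_mem_sphere, mul_one]
    exact hC _

/-- The divergence theorem on balls. Both sides are continuous in the radius, and tested against a
function `ψ` of the radius they agree: this is integration by parts against the radial cutoff
`x ↦ ∫_{|x|}^∞ ψ`, written in polar coordinates. -/
theorem setIntegral_ball_divergence {n : ℕ} {X : E n → E n} (hX : ContDiff ℝ 1 X)
    (hXc : HasCompactSupport X) {r : ℝ} (hr : 0 < r) :
    ∫ x in Metric.ball 0 r, divergence X x =
      r ^ n * ∫ θ : Metric.sphere (0 : E n) 1, ⟪X (r • (θ : E n)), (θ : E n)⟫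
        ∂(volume : Measure (E n)).toSphere := by
  have hdi : Integrable (divergence X) :=
    (continuous_divergence hX).integrable_of_hasCompactSupport (hasCompactSupport_divergence hXc)
  have hF := continuous_setIntegral_ball volume hdi
  have hG : Continuous fun t : ℝ => t ^ n * ∫ θ : Metric.sphere (0 : E n) 1,
      ⟪X (t • (θ : E n)), (θ : E n)⟫ ∂(volume : Measure (E n)).toSphere :=
    (continuous_pow n).mul (continuous_sphere_flux hX.continuous hXc)
  obtain ⟨F, hFdef⟩ : ∃ F : ℝ → ℝ, F = fun t => ∫ x in Metric.ball 0 t, divergence X x := ⟨_, rfl⟩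
  obtain ⟨G, hGdef⟩ : ∃ G : ℝ → ℝ, G = fun t => t ^ n * ∫ θ : Metric.sphere (0 : E n) 1,
      ⟪X (t • (θ : E n)), (θ : E n)⟫ ∂(volume : Measure (E n)).toSphere := ⟨_, rfl⟩
  rw [← hFdef] at hF
  rw [← hGdef] at hG
  have htest : ∀ ψ : ℝ → ℝ, ContDiff ℝ ∞ ψ → HasCompactSupport ψ → tsupport ψ ⊆ Ioi 0 →
      ∫ t, ψ t • (F t - G t) = 0 := by
    intro ψ hψ hψc hψs
    have hψi : Integrable ψ := hψ.continuous.integrable_of_hasCompactSupport hψc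
    have hζ := contDiff_integral_Ioi_norm (V := E n) hψ.continuous hψc hψs
    have h1 := integral_mul_divergence hζ hX hXc
    rw [integral_integral_Ioi_norm_mul hψi hdi, integral_eq_integral_Ioi_toSphere (V := E n)] at h1
    · have h2 : ∫ t, ψ t * F t = ∫ t, ψ t * G t := by
        have hsupp : ∀ t ∉ Ioi (0 : ℝ), ψ t * G t = 0 := fun t ht => by
          rw [image_eq_zero_of_notMem_tsupport fun h => ht (hψs h), zero_mul]
        rw [hFdef, h1, ← integral_neg, ← setIntegral_eq_integral_of_forall_compl_eq_zero hsupp]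
        refine setIntegral_congr_fun measurableSet_Ioi fun s hs => ?_
        have hs' : (0 : ℝ) < s := hs
        have h3 : ∀ θ : Metric.sphere (0 : E n) 1,
            fderiv ℝ (fun x : E n => ∫ t in Ioi ‖x‖, ψ t) (s • (θ : E n)) (X (s • (θ : E n)))
              = -ψ s * ⟪X (s • (θ : E n)), (θ : E n)⟫ := by
          intro θ
          have hθ : ‖s • (θ : E n)‖ = s := by
            rw [norm_smul, norm_eq_of_mem_sphere, mul_one, Real.norm_of_nonneg hs'.le]
          rw [fderiv_integral_Ioi_norm hψ.continuous hψi
            (norm_ne_zero_iff.mp (hθ.symm ▸ hs'.ne')), hθ, smul_smul,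
            inv_mul_cancel₀ hs'.ne', one_smul]
          ring
        simp only [h3, integral_const_mul, hGdef, finrank_euclideanSpace, Fintype.card_fin,
          Nat.add_sub_cancel]
        ring
      simp only [smul_eq_mul, mul_sub]
      rw [integral_sub, h2, sub_self]
      · exact (hψ.continuous.mul hF).integrable_of_hasCompactSupport hψc.mul_right
      · exact (hψ.continuous.mul hG).integrable_of_hasCompactSupport hψc.mul_right
    · refine ((hζ.continuous_fderiv one_ne_zero).clm_apply
        hX.continuous).integrable_of_hasCompactSupport (hXc.mono fun x hx hx' => hx ?_)
      simp only [hx', map_zero]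
  have hae := isOpen_Ioi.ae_eq_zero_of_integral_contDiff_smul_eq_zero
    ((hF.sub hG).locallyIntegrable.locallyIntegrableOn _) htest
  have heq := Measure.eqOn_open_of_ae_eq (μ := volume) (f := fun t => F t - G t) (g := fun _ => 0)
    ((ae_restrict_iff' measurableSet_Ioi).mpr hae) isOpen_Ioi (hF.sub hG).continuousOn
    continuousOn_const hr
  rw [hFdef, hGdef] at heq
  exact sub_eq_zero.mp heq

end PMC

/-! ### Balls as Caccioppoli sets -/

namespace PMC

/-- The area measure of the sphere of radius `r` around `p`, parametrized by the unit sphere. -/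
noncomputable def sphereMeasure {n : ℕ} (p : E n) (r : ℝ) : Measure (E n) :=
  ENNReal.ofReal (r ^ n) •
    (volume : Measure (E n)).toSphere.map fun θ : Metric.sphere (0 : E n) 1 => p + r • (θ : E n)

theorem norm_inv_smul_mem_unit_sphere {n : ℕ} {v : E n} (hv : v ≠ 0) :
    ‖v‖⁻¹ • v ∈ Metric.sphere (0 : E n) 1 := by
  rw [mem_sphere_zero_iff_norm, norm_smul, norm_inv, norm_norm,
    inv_mul_cancel₀ (norm_ne_zero_iff.mpr hv)]

open Classical in
/-- The unit vector field `x ↦ (x - p) / |x - p|`, with an arbitrary value at the center `p`. -/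
noncomputable def radialNormal {n : ℕ} (p : E n) (x : E n) : Metric.sphere (0 : E n) 1 :=
  if h : x - p = 0 then Classical.arbitrary _
  else ⟨‖x - p‖⁻¹ • (x - p), norm_inv_smul_mem_unit_sphere h⟩

theorem measurable_radialNormal {n : ℕ} (p : E n) : Measurable (radialNormal p) := by
  have hs : MeasurableSet {x : E n | x - p = 0} :=
    (isClosed_eq (by fun_prop) (by fun_prop)).measurableSet
  let g : ({x : E n | x - p = 0}ᶜ : Set (E n)) → Metric.sphere (0 : E n) 1 := fun x =>
    ⟨‖(x : E n) - p‖⁻¹ • ((x : E n) - p), norm_inv_smul_mem_unit_sphere x.2⟩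
  have hg : Measurable g := by
    refine Measurable.subtype_mk ?_
    fun_prop
  exact Measurable.dite (f := fun _ => Classical.arbitrary _) measurable_const hg hs

theorem radialNormal_add_smul {n : ℕ} (p : E n) {r : ℝ} (hr : 0 < r)
    (θ : Metric.sphere (0 : E n) 1) : radialNormal p (p + r • (θ : E n)) = θ := by
  have hθ : ‖r • (θ : E n)‖ = r := by
    rw [norm_smul, norm_eq_of_mem_sphere, mul_one, Real.norm_of_nonneg hr.le]
  have h0 : p + r • (θ : E n) - p ≠ 0 := by
    rw [add_sub_cancel_left]
    exact norm_ne_zero_iff.mp (hθ.symm ▸ hr.ne')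
  rw [radialNormal, dif_neg h0]
  apply Subtype.ext
  simp only [add_sub_cancel_left]
  rw [hθ, smul_smul, inv_mul_cancel₀ hr.ne', one_smul]

theorem continuous_add_smul_sphere {n : ℕ} (p : E n) (r : ℝ) :
    Continuous fun θ : Metric.sphere (0 : E n) 1 => p + r • (θ : E n) := by
  fun_prop

theorem divergence_comp_const_add {n : ℕ} (X : E n → E n) (p x : E n) :
    divergence (fun y => X (p + y)) x = divergence X (p + x) := by
  simp only [divergence, fderiv_comp_add_left]

theorem setIntegral_ball_center {n : ℕ} (f : E n → ℝ) (p : E n) (r : ℝ) :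
    ∫ x in Metric.ball p r, f x = ∫ x in Metric.ball 0 r, f (p + x) := by
  rw [← integral_indicator Metric.isOpen_ball.measurableSet,
    ← integral_indicator Metric.isOpen_ball.measurableSet,
    ← integral_add_left_eq_self _ p]
  refine integral_congr_ae (Eventually.of_forall fun x => ?_)
  simp [indicator, dist_eq_norm]

theorem isGaussGreenPair_ball {n : ℕ} (hn : n ≠ 0) (p : E n) {r : ℝ} (hr : 0 ≤ r) :
    IsGaussGreenPair (Metric.ball p r) (sphereMeasure p r) (radialNormal p) where
  finite := by
    have := Measure.isFiniteMeasure_map (volume : Measure (E n)).toSphere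
      fun θ : Metric.sphere (0 : E n) 1 => p + r • (θ : E n)
    exact Measure.smul_finite _ ENNReal.ofReal_ne_top
  measurable := measurable_radialNormal p
  integral_divergence X hX hXc := by
    rcases hr.eq_or_lt with rfl | hr
    -- For `r = 0` the ball is empty, and `sphereMeasure p 0 = 0` since `n ≠ 0`.
    · simp [sphereMeasure, hn]
    have hm : StronglyMeasurable fun x => ⟪X x, (radialNormal p x : E n)⟫ :=
      (hX.continuous.measurable.inner
        (measurable_radialNormal p).subtype_val).stronglyMeasurable
    rw [sphereMeasure, integral_smul_measure, integral_map
      (continuous_add_smul_sphere p r).measurable.aemeasurable hm.aestronglyMeasurable,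
      setIntegral_ball_center, ENNReal.toReal_ofReal (by positivity), smul_eq_mul]
    simp only [radialNormal_add_smul p hr, ← divergence_comp_const_add]
    exact setIntegral_ball_divergence (hX.comp (contDiff_const.add contDiff_id))
      (hXc.comp_homeomorph (Homeomorph.addLeft p)) hr

theorem isCaccioppoli_ball {n : ℕ} (hn : n ≠ 0) (p : E n) {r : ℝ} (hr : 0 ≤ r) :
    IsCaccioppoli (Metric.ball p r) where
  measurableSet := Metric.isOpen_ball.measurableSet
  isBounded := Metric.isBounded_ball
  hasFinitePerimeter := ⟨_, _, isGaussGreenPair_ball hn p hr⟩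

theorem volume_real_ball {n : ℕ} (p : E n) {r : ℝ} (hr : 0 ≤ r) :
    volume.real (Metric.ball p r) = r ^ (n + 1) * volume.real (Metric.ball (0 : E n) 1) := by
  rw [measureReal_def, Measure.addHaar_ball volume p hr, ENNReal.toReal_mul,
    ENNReal.toReal_ofReal (by positivity), finrank_euclideanSpace, Fintype.card_fin,
    measureReal_def]

theorem volume_real_unit_ball_pos (n : ℕ) : 0 < volume.real (Metric.ball (0 : E n) 1) :=
  ENNReal.toReal_pos (Metric.measure_ball_pos volume 0 one_pos).ne' measure_ball_lt_top.ne

theorem area_ball {n : ℕ} (hn : n ≠ 0) (p : E n) {r : ℝ} (hr : 0 ≤ r) :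
    area (Metric.ball p r) = r ^ n * ((n + 1) * volume.real (Metric.ball (0 : E n) 1)) := by
  rw [area, (isGaussGreenPair_ball hn p hr).eq_perimeterMeasure, sphereMeasure,
    measureReal_ennreal_smul_apply, map_measureReal_apply
      (continuous_add_smul_sphere p r).measurable MeasurableSet.univ, preimage_univ,
    Measure.toSphere_real_apply_univ, ENNReal.toReal_ofReal (by positivity)]
  simp

theorem A_const_ball {n : ℕ} (hn : n ≠ 0) (c : ℝ) (p : E n) {r : ℝ} (hr : 0 ≤ r) :
    A (fun _ => c) (Metric.ball p r)
      = ((n + 1) * r ^ n - c * r ^ (n + 1)) * volume.real (Metric.ball (0 : E n) 1) := by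
  rw [A, area_ball hn p hr, setIntegral_const, volume_real_ball p hr, smul_eq_mul]
  ring

/-! ### The family of concentric balls -/

theorem boundaryVarifold_ball {n : ℕ} (hn : n ≠ 0) (p : E n) {r : ℝ} (hr : 0 ≤ r) :
    boundaryVarifold (Metric.ball p r) = ENNReal.ofReal (r ^ n) •
      (volume : Measure (E n)).toSphere.map
        fun θ : Metric.sphere (0 : E n) 1 => (p + r • (θ : E n), hyperplane θ) := by
  have hG := isGaussGreenPair_ball hn p hr
  have hae := hG.ae_eq_outerNormal
  have hmap : boundaryVarifold (Metric.ball p r)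
      = (sphereMeasure p r).map fun x => (x, hyperplane (radialNormal p x)) := by
    rw [boundaryVarifold, ← hG.eq_perimeterMeasure]
    refine Measure.map_congr ?_
    filter_upwards [hae] with x hx
    rw [hx]
  rw [hmap]
  rcases hr.eq_or_lt with rfl | hr
  · simp [sphereMeasure, hn]
  have hmeas : Measurable fun x : E n => (x, hyperplane (radialNormal p x)) :=
    measurable_id.prodMk ((continuous_hyperplane n).measurable.comp (measurable_radialNormal p))
  rw [sphereMeasure, Measure.map_smul, Measure.map_map hmeas
    (continuous_add_smul_sphere p r).measurable]
  congr 2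
  funext θ
  simp only [Function.comp_apply, radialNormal_add_smul p hr]

theorem integral_boundaryVarifold_ball {n : ℕ} (hn : n ≠ 0) (p : E n) {r : ℝ} (hr : 0 ≤ r)
    {f : E n × Gr n → ℝ} (hf : Continuous f) :
    ∫ z, f z ∂(boundaryVarifold (Metric.ball p r)) = r ^ n *
      ∫ θ : Metric.sphere (0 : E n) 1, f (p + r • (θ : E n), hyperplane θ)
        ∂(volume : Measure (E n)).toSphere := by
  rw [boundaryVarifold_ball hn p hr, integral_smul_measure, integral_map
    ((continuous_add_smul_sphere p r).prodMk (continuous_hyperplane n)).measurable.aemeasurable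
    hf.aestronglyMeasurable, ENNReal.toReal_ofReal (by positivity), smul_eq_mul]

/-- A bounded Lipschitz test function changes along the family of spheres only through the total
mass and the displacement `|r - s|` of the base points: the tangent planes do not depend on the
radius. -/
theorem varifoldDist_ball_le {n : ℕ} (hn : n ≠ 0) (p : E n) {r s : ℝ} (hr : 0 ≤ r) (hs : 0 ≤ s) :
    varifoldDist (boundaryVarifold (Metric.ball p r)) (boundaryVarifold (Metric.ball p s))
      ≤ (|r ^ n - s ^ n| + s ^ n * |r - s|) *
        (volume : Measure (E n)).toSphere.real univ := by
  refine Real.sSup_le ?_ (by positivity)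
  rintro _ ⟨f, -, hf1, hfL, rfl⟩
  have hfc := hfL.continuous
  obtain ⟨I, hI⟩ : ∃ I : ℝ → ℝ, I = fun t => ∫ θ : Metric.sphere (0 : E n) 1,
    f (p + t • (θ : E n), hyperplane θ) ∂(volume : Measure (E n)).toSphere := ⟨_, rfl⟩
  have hint : ∀ t : ℝ, Integrable (fun θ : Metric.sphere (0 : E n) 1 =>
      f (p + t • (θ : E n), hyperplane θ)) (volume : Measure (E n)).toSphere := fun t =>
    Integrable.of_bound (hfc.comp ((continuous_add_smul_sphere p t).prodMk
      (continuous_hyperplane n))).aestronglyMeasurable 1 (Eventually.of_forall fun θ => hf1 _)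
  have hV : ∀ t : ℝ, 0 ≤ t →
      ∫ z, f z ∂(boundaryVarifold (Metric.ball p t)) = t ^ n * I t := fun t ht => by
    rw [integral_boundaryVarifold_ball hn p ht hfc, hI]
  rw [hV r hr, hV s hs]
  have h1 : |I r| ≤ (volume : Measure (E n)).toSphere.real univ := by
    rw [hI]
    simpa using norm_integral_le_of_norm_le_const (μ := (volume : Measure (E n)).toSphere)
      (f := fun θ : Metric.sphere (0 : E n) 1 => f (p + r • (θ : E n), hyperplane θ)) (C := 1)
      (Eventually.of_forall fun θ => hf1 _)
  have h2 : |I r - I s| ≤ |r - s| * (volume : Measure (E n)).toSphere.real univ := by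
    rw [hI]
    simp only
    rw [← integral_sub (hint r) (hint s)]
    rw [← Real.norm_eq_abs]
    refine norm_integral_le_of_norm_le_const (Eventually.of_forall fun θ => ?_)
    have := hfL.dist_le_mul (p + r • (θ : E n), hyperplane θ) (p + s • (θ : E n), hyperplane θ)
    rw [Prod.dist_eq, dist_self, dist_add_left, dist_eq_norm (r • (θ : E n)), ← sub_smul,
      norm_smul, norm_eq_of_mem_sphere, mul_one, max_eq_left (norm_nonneg _)] at this
    simpa [Real.dist_eq] using this
  calc r ^ n * I r - s ^ n * I s = (r ^ n - s ^ n) * I r + s ^ n * (I r - I s) := by ring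
    _ ≤ |r ^ n - s ^ n| * |I r| + s ^ n * |I r - I s| := by
        refine add_le_add ?_ (mul_le_mul_of_nonneg_left (le_abs_self _) (by positivity))
        rw [← abs_mul]
        exact le_abs_self _
    _ ≤ |r ^ n - s ^ n| * (volume : Measure (E n)).toSphere.real univ +
        s ^ n * (|r - s| * (volume : Measure (E n)).toSphere.real univ) := by gcongr
    _ = _ := by ring

theorem flatDist_ball {n : ℕ} (p : E n) {r s : ℝ} (hr : 0 ≤ r) (hs : 0 ≤ s) :
    flatDist (Metric.ball p r) (Metric.ball p s)
      = |r ^ (n + 1) - s ^ (n + 1)| * volume.real (Metric.ball (0 : E n) 1) := by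
  have key : ∀ {r s : ℝ}, 0 ≤ r → r ≤ s → flatDist (Metric.ball p r) (Metric.ball p s)
      = |r ^ (n + 1) - s ^ (n + 1)| * volume.real (Metric.ball (0 : E n) 1) := by
    intro r s hr hrs
    have hsub := Metric.ball_subset_ball (x := p) hrs
    rw [flatDist, symmDiff_of_le hsub, measureReal_sdiff hsub Metric.isOpen_ball.measurableSet
      (by finiteness), volume_real_ball p hr, volume_real_ball p (hr.trans hrs), abs_sub_comm,
      abs_of_nonneg (sub_nonneg.mpr (pow_le_pow_left₀ hr hrs _))]
    ring
  rcases le_total r s with h | h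
  · exact key hr h
  · rw [flatDist, symmDiff_comm, abs_sub_comm]
    exact key hs h

theorem tendsto_FDist_ball {n : ℕ} (hn : n ≠ 0) (p : E n) {R : ℝ} (hR : 0 ≤ R)
    (s : unitInterval) :
    Tendsto (fun t : unitInterval => FDist (Metric.ball p ((t : ℝ) * R))
      (Metric.ball p ((s : ℝ) * R))) (𝓝 s) (𝓝 0) := by
  have hnn : ∀ t : unitInterval, 0 ≤ (t : ℝ) * R := fun t => mul_nonneg t.2.1 hR
  have hc : Continuous fun t : unitInterval =>
      |((t : ℝ) * R) ^ (n + 1) - ((s : ℝ) * R) ^ (n + 1)| *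
        volume.real (Metric.ball (0 : E n) 1) +
      (|((t : ℝ) * R) ^ n - ((s : ℝ) * R) ^ n| +
        ((s : ℝ) * R) ^ n * |(t : ℝ) * R - (s : ℝ) * R|) *
        (volume : Measure (E n)).toSphere.real univ := by
    fun_prop
  have hlim := hc.tendsto s
  simp only [sub_self, abs_zero, mul_zero, zero_mul, add_zero] at hlim
  refine squeeze_zero (fun t => add_nonneg measureReal_nonneg (varifoldDist_nonneg _ _))
    (fun t => ?_) hlim
  rw [FDist, flatDist_ball p (hnn t) (hnn s)]
  gcongr
  exact varifoldDist_ball_le hn p (hnn t) (hnn s)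

/-! ### The upper bound -/

theorem isMountainPassPath_ball {n : ℕ} (hn : n ≠ 0) {h : E n → ℝ} (p : E n) {R : ℝ}
    (hR : 0 ≤ R) (hfin : A h (Metric.ball p R) < 0) :
    IsMountainPassPath h fun t => Metric.ball p ((t : ℝ) * R) where
  isCaccioppoli t := isCaccioppoli_ball hn p (mul_nonneg t.2.1 hR)
  continuous := tendsto_FDist_ball hn p hR
  initial := by simp
  final := by simpa using hfin

theorem A_ball_le {n : ℕ} (hn : n ≠ 0) {h : E n → ℝ} (hc : Continuous h) {c ε : ℝ} (p : E n)
    {r : ℝ} (hr : 0 ≤ r) (hh : ∀ x ∈ Metric.ball p r, c - ε ≤ h x) :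
    A h (Metric.ball p r) ≤ A (fun _ => c) (Metric.ball (0 : E n) r)
      + ε * r ^ (n + 1) * volume.real (Metric.ball (0 : E n) 1) := by
  have h1 := (isCaccioppoli_ball hn p hr).setIntegral_le hc.neg
    (fun x hx => neg_le_neg (hh x hx))
  simp only [Pi.neg_apply, integral_neg, volume_real_ball p hr] at h1
  rw [A_const_ball hn c 0 hr, A, area_ball hn p hr]
  linarith

theorem add_one_mul_pow_sub_le_one {x : ℝ} (hx : 0 ≤ x) (n : ℕ) :
    (n + 1) * x ^ n - n * x ^ (n + 1) ≤ 1 := by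
  induction n with
  | zero => simp
  | succ n ih =>
    have h1 : 0 ≤ (x - 1) * (x ^ (n + 1) - 1) := by
      rcases le_total x 1 with h | h
      · exact mul_nonneg_of_nonpos_of_nonpos (by linarith)
          (by linarith [pow_le_one₀ hx h (n := n + 1)])
      · exact mul_nonneg (by linarith) (by linarith [one_le_pow₀ h (n := n + 1)])
    have h2 := mul_le_mul_of_nonneg_left ih hx
    push_cast
    have e : ((n : ℝ) + 1 + 1) * x ^ (n + 1) - (n + 1) * x ^ (n + 1 + 1)
        = x * ((n + 1) * x ^ n - n * x ^ (n + 1)) + 1 - x - (x - 1) * (x ^ (n + 1) - 1) := by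
      ring
    linarith

/-- Among concentric balls, `A^c` is largest at the radius `n / c`. -/
theorem A_const_ball_le {n : ℕ} (hn : n ≠ 0) {c : ℝ} (hc : 0 < c) {r : ℝ} (hr : 0 ≤ r) :
    A (fun _ => c) (Metric.ball (0 : E n) r)
      ≤ A (fun _ => c) (Metric.ball (0 : E n) (n / c)) := by
  have hn' : (0 : ℝ) < n := by positivity
  rw [A_const_ball hn c 0 hr, A_const_ball hn c 0 (by positivity)]
  gcongr ?_ * _
  obtain ⟨k, hk⟩ : ∃ k : ℝ, k = n / c := ⟨_, rfl⟩
  have hk0 : 0 < k := hk ▸ by positivity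
  have hck : c * k = n := by rw [hk]; field_simp
  obtain ⟨x, rfl⟩ : ∃ x, r = x * k := ⟨r / k, by field_simp⟩
  have hx : 0 ≤ x := nonneg_of_mul_nonneg_left hr hk0
  have h := mul_le_mul_of_nonneg_left (add_one_mul_pow_sub_le_one hx n) (pow_nonneg hk0.le n)
  rw [← hk]
  calc (n + 1) * (x * k) ^ n - c * (x * k) ^ (n + 1)
      = k ^ n * ((n + 1) * x ^ n - n * x ^ (n + 1)) := by
        rw [mul_pow, mul_pow]
        linear_combination -(k ^ n * x ^ (n + 1)) * hck
    _ ≤ k ^ n * 1 := h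
    _ = (n + 1) * k ^ n - c * k ^ (n + 1) := by linear_combination k ^ n * hck

/-- Far away from the origin the concentric balls of radius up to `(n + 2) / c` form a mountain
pass path along which `A^h` nearly equals `A^c`. -/
theorem width_le {n : ℕ} (hn : n ≠ 0) {h : E n → ℝ} (hcont : Continuous h) {c : ℝ} (hc : 0 < c)
    (hlim : Tendsto h (cocompact (E n)) (𝓝 c)) :
    width h ≤ ((A (fun _ => c) (Metric.ball (0 : E n) (n / c)) : ℝ) : EReal) := by
  refine le_of_forall_gt_imp_ge_of_dense fun a ha => ?_
  obtain ⟨a', ha', haa'⟩ := EReal.lt_iff_exists_real_btwn.mp ha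
  refine le_trans ?_ haa'.le
  have hδ := sub_pos.mpr (EReal.coe_lt_coe_iff.mp ha')
  obtain ⟨δ, hδdef⟩ : ∃ δ, δ = a' - A (fun _ => c) (Metric.ball (0 : E n) (n / c)) := ⟨_, rfl⟩
  rw [← hδdef] at hδ
  obtain ⟨b, hb⟩ : ∃ b, b = volume.real (Metric.ball (0 : E n) 1) := ⟨_, rfl⟩
  have hb0 : 0 < b := hb ▸ volume_real_unit_ball_pos n
  -- `A^c` of a ball of this radius is `-R ^ n * b`.
  obtain ⟨R, hR⟩ : ∃ R : ℝ, R = (n + 2) / c := ⟨_, rfl⟩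
  have hR0 : 0 < R := hR ▸ by positivity
  obtain ⟨ε, hε0, hε1, hε2⟩ : ∃ ε : ℝ, 0 < ε ∧ ε * R < 1 ∧ ε * R ^ (n + 1) * b ≤ δ := by
    refine ⟨min (1 / (2 * R)) (δ / (R ^ (n + 1) * b)), by positivity, ?_, ?_⟩
    · calc _ ≤ 1 / (2 * R) * R := by gcongr; exact min_le_left _ _
        _ = 1 / 2 := by field_simp
        _ < 1 := by norm_num
    · calc _ ≤ δ / (R ^ (n + 1) * b) * R ^ (n + 1) * b := by gcongr; exact min_le_right _ _
        _ = δ := by field_simp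
  obtain ⟨K, hK, hKs⟩ := mem_cocompact.mp (hlim.eventually (lt_mem_nhds (sub_lt_self c hε0)))
  obtain ⟨T, hT⟩ := hK.isBounded.subset_closedBall (0 : E n)
  obtain ⟨p, hp⟩ := NormedSpace.exists_lt_norm ℝ (E n) (T + R)
  have hh : ∀ r ≤ R, ∀ x ∈ Metric.ball p r, c - ε ≤ h x := by
    intro r hr x hx
    refine (hKs fun hxK => ?_ : c - ε < h x).le
    have h1 : ‖x‖ ≤ T := by simpa using hT hxK
    have h2 : ‖x - p‖ < R := (mem_ball_iff_norm.mp hx).trans_le hr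
    have h3 := norm_sub_norm_le p x
    rw [norm_sub_rev] at h3
    linarith
  have hfin : A h (Metric.ball p R) < 0 := by
    refine (A_ball_le hn hcont p hR0.le (hh R le_rfl)).trans_lt ?_
    rw [A_const_ball hn c 0 hR0.le, ← hb, ← add_mul]
    refine mul_neg_of_neg_of_pos ?_ hb0
    have hcR : c * R = n + 2 := by rw [hR]; field_simp
    have : (n + 1) * R ^ n - c * R ^ (n + 1) + ε * R ^ (n + 1)
        = R ^ n * ((n + 1) - c * R + ε * R) := by ring
    rw [this, hcR]
    exact mul_neg_of_pos_of_neg (by positivity) (by linarith)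
  refine iInf₂_le_of_le _ (isMountainPassPath_ball hn p hR0.le hfin) (iSup_le fun t => ?_)
  rw [EReal.coe_le_coe_iff]
  have ht0 : 0 ≤ (t : ℝ) * R := mul_nonneg t.2.1 hR0.le
  have htR : (t : ℝ) * R ≤ R := mul_le_of_le_one_left hR0.le t.2.2
  have h1 := A_ball_le hn hcont p ht0 (hh _ htR)
  have h2 := A_const_ball_le hn hc ht0
  have h3 : ε * ((t : ℝ) * R) ^ (n + 1) * b ≤ ε * R ^ (n + 1) * b := by gcongr
  rw [← hb] at h1
  linarith

end PMC

theorem mainTheorem7 (n : ℕ) (hn2 : 2 ≤ n) (hn6 : n ≤ 6) (h : PMC.E n → ℝ) (c : ℝ) (hc : 0 < c)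
    (hsmooth : ContDiff ℝ ∞ h)
    (H1 : PMC.ConvergesSmoothlyAtInfinity h c)
    (H2 : PMC.RadialDerivativeBound h) :
    0 < PMC.width h ∧
      PMC.width h ≤ ((PMC.A (fun _ => c) (Metric.ball (0 : PMC.E n) (n / c)) : ℝ) : EReal) := by
  obtain ⟨M, hM0, hM⟩ := PMC.exists_forall_le_of_tendsto_cocompact hsmooth.continuous H1.tendsto
  exact ⟨PMC.width_pos (by omega) hsmooth.continuous hM0 hM,
    PMC.width_le (by omega) hsmooth.continuous hc H1.tendsto⟩
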